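/- Let $\mathbb K$ be a field of characteristic zero and $r\ge 0$. For $\vec i\in\mathbb Z^r$ let $N^{\vec i}$ be the shift $n_j\mapsto n_j+i_j$ $(j=1,\dots,r)$ on $\mathbb K[n_1,\dots,n_r]$ and on $\mathbb K(n_1,\dots,n_r)$. Consider an equation $$\sum_{\vec s\in S}a_{\vec s}\,N^{\vec s}y=f \qquad (*)$$ with $S\subseteq\mathbb Z^r$ finite and nonempty, $a_{\vec s}\in\mathbb K[\vec n]\setminus\{0\}$ for $\vec s\in S$, and $f\in\mathbb K[\vec n]$; solutions are sought in $\mathbb K(\vec n)$. Definitions. - For an irreducible polynomial $u$ put $\operatorname{Spread}(u)=\{\vec i\in\mathbb Z^r:\gcd(u,N^{\vec i}u)\ne1\}$. - For a set $W\subseteq\mathbb Z^r$, a polynomial $d\neq0$ is a *denominator bound of $(*)$ with respect to $W$* if for every solution $y=p/q$ in lowest terms, every irreducible factor $u$ of $q$ with $\operatorname{Spread}(u)\subseteq W$, and every $m$ with $u^m\mid q$, we have $u^m\mid d$. - A point $\vec p\in S$ is a *corner point* of $S$ if there is $\vec v\in\mathbb R^r$ with $(\vec s-\vec p)\cdot\vec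 v>0$ for all $\vec s\in S\setminus\{\vec p\}$. - Let $W$ be a submodule of $\mathbb Z^r$. A pair $(\vec p,\vec p')$ of corner points is *useful for $W$* if there is a vector $\vec v\in\mathbb R^r$ orthogonal to $W$ such that $(\vec s-\vec p)\cdot\vec v\ge0$ and $(\vec p'-\vec s)\cdot\vec v\ge 0$ for all $\vec s\in S$ (a witness that the pair is opposite), and such that neither $\{\vec s\in S:(\vec s-\vec p)\cdot\vec v=0\}$ nor $\{\vec s\in S:(\vec s-\vec p')\cdot\vec v=0\}$ contains two distinct points whose difference has a nonzero integer multiple in $W$. - $U$ is the set of all submodules $W$ of $\mathbb Z^r$ for which a useful pair exists. Algorithm. Start with $d:=1$. For every corner point $\vec q$ of $S$ and every irreducible factor $u$ of $a_{\vec q}$ (up to units, in any order): if $\operatorname{Spread}(u)\in U$, compute some denominator bound $d_0$ of $(*)$ with respect to $\operatorname{Spread}(u)$ and replace $d$ by $\operatorname{lcm}(d,d_0)$; otherwise leave $d$ unchanged. Return $d$. Theorem. The algorithm can be carried out on every equation $(*)$ (the denominator bounds $d_0$ that it asks for exist), and, whatever choices are made, every polynomial $d$ it returns is a denominator bound of $(*)$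 with respect to $W_1\cup\dots\cup W_m$ for any finite set of modules $W_1,\dots,W_m\in U$. -/

import Mathlib

open MvPolynomial

namespace PLDE

/-- The field `K(n₁, …, n_r)` of rational functions. -/
abbrev RatFunc (K : Type*) [Field K] (r : ℕ) : Type _ :=
  FractionRing (MvPolynomial (Fin r) K)

/-- The shift `N^i` on polynomials: `n_j ↦ n_j + i_j` for all `j`, where `i ∈ ℤ^r`. -/
noncomputable def shiftHom (K : Type*) [Field K] {r : ℕ} (i : Fin r → ℤ) :
    MvPolynomial (Fin r) K →ₐ[K] MvPolynomial (Fin r) K :=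
  aeval fun j => X j + C ((i j : ℤ) : K)

theorem shiftHom_comp (K : Type*) [Field K] {r : ℕ} (i j : Fin r → ℤ) (h : i + j = 0) :
    (shiftHom K i).comp (shiftHom K j) = AlgHom.id K _ := by
  ext1 k
  have hk : ((i k : ℤ) : K) + ((j k : ℤ) : K) = 0 := by
    rw [← Int.cast_add, ← Pi.add_apply, h, Pi.zero_apply, Int.cast_zero]
  simp only [shiftHom, AlgHom.comp_apply, aeval_X, map_add, AlgHom.id_apply]
  rw [MvPolynomial.algHom_C, MvPolynomial.algebraMap_eq, add_assoc, ← C_add, hk, C_0, add_zero]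

/-- The shift `N^i` as an automorphism of the polynomial ring, with inverse `N^(-i)`. -/
noncomputable def shift (K : Type*) [Field K] {r : ℕ} (i : Fin r → ℤ) :
    MvPolynomial (Fin r) K ≃ₐ[K] MvPolynomial (Fin r) K :=
  AlgEquiv.ofAlgHom (shiftHom K i) (shiftHom K (-i))
    (shiftHom_comp K i (-i) (add_neg_cancel i)) (shiftHom_comp K (-i) i (neg_add_cancel i))

/-- The shift `N^i` on rational functions: the unique extension of the shift on polynomials. -/
noncomputable def ratShift (K : Type*) [Field K] {r : ℕ} (i : Fin r → ℤ) :
    RatFunc K r ≃ₐ[K] RatFunc K r :=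
  IsFractionRing.fieldEquivOfAlgEquiv K (RatFunc K r) (RatFunc K r) (shift K i)

/-- `Spread(p, q) = {i ∈ ℤ^r : gcd(p, N^i q) ≠ 1}`. -/
def spread {K : Type*} [Field K] {r : ℕ} (p q : MvPolynomial (Fin r) K) : Set (Fin r → ℤ) :=
  {i | ¬ IsRelPrime p (shift K i q)}

/-- The inner product `x · v` of an integer vector with a real vector. -/
def dot {r : ℕ} (x : Fin r → ℤ) (v : Fin r → ℝ) : ℝ := ∑ j, (x j : ℝ) * v j

/-- `p` is a corner point of `S`: some `v ∈ ℝ^r` has `(s - p) · v > 0` for all `s ∈ S \ {p}`. -/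
def IsCornerPoint {r : ℕ} (S : Finset (Fin r → ℤ)) (p : Fin r → ℤ) : Prop :=
  p ∈ S ∧ ∃ v : Fin r → ℝ, ∀ s ∈ S, s ≠ p → 0 < dot (s - p) v

/-- `v` is a witness vector for the oppositeness of the pair `(p, p')`:
`(s - p) · v ≥ 0` and `(p' - s) · v ≥ 0` for all `s ∈ S`. -/
def IsWitness {r : ℕ} (S : Finset (Fin r → ℤ)) (p p' : Fin r → ℤ) (v : Fin r → ℝ) : Prop :=
  ∀ s ∈ S, 0 ≤ dot (s - p) v ∧ 0 ≤ dot (p' - s) v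

/-- `v` is orthogonal to the submodule `W` of `ℤ^r`. -/
def Orthogonal {r : ℕ} (W : Submodule ℤ (Fin r → ℤ)) (v : Fin r → ℝ) : Prop :=
  ∀ w ∈ W, dot w v = 0

/-- No two distinct points of `S` on the plane `{x : (x - p) · v = 0}` have a difference lying
in the rational span of `W` (that is, with a nonzero integer multiple in `W`). If `v` spans the
first axis and `W = {0}^t × ℤ^(r-t)`, this says that no two elements of
`{s ∈ S : s₁ = p₁}` agree in the first `t` coordinates. -/
def SeparatedOnFace {r : ℕ} (S : Finset (Fin r → ℤ)) (W : Submodule ℤ (Fin r → ℤ))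
    (p : Fin r → ℤ) (v : Fin r → ℝ) : Prop :=
  ∀ s ∈ S, ∀ t ∈ S, dot (s - p) v = 0 → dot (t - p) v = 0 →
    (∃ k : ℤ, k ≠ 0 ∧ k • (s - t) ∈ W) → s = t

/-- The pair of corner points `(p, p')` of `S` is useful for `W`: it has a witness vector `v`,
orthogonal to `W`, such that both faces of `S` cut out by `v` (the one through `p` and the one
through `p'`) are separated modulo `W`. -/
def IsUseful {r : ℕ} (S : Finset (Fin r → ℤ)) (W : Submodule ℤ (Fin r → ℤ))
    (p p' : Fin r → ℤ) : Prop :=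
  IsCornerPoint S p ∧ IsCornerPoint S p' ∧
    ∃ v : Fin r → ℝ, IsWitness S p p' v ∧ Orthogonal W v ∧
      SeparatedOnFace S W p v ∧ SeparatedOnFace S W p' v

/-- The set `U` of all submodules of `ℤ^r` that admit a useful pair. -/
def usefulModules {r : ℕ} (S : Finset (Fin r → ℤ)) : Set (Submodule ℤ (Fin r → ℤ)) :=
  {W | ∃ p p', IsUseful S W p p'}

/-- A partial linear difference equation `∑_{s ∈ S} a_s N^s y = f` with finite nonempty support
`S ⊆ ℤ^r`, nonzero polynomial coefficients `a_s` (`s ∈ S`) and polynomial right hand side. -/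
structure Equation (K : Type*) [Field K] (r : ℕ) where
  S : Finset (Fin r → ℤ)
  nonempty : S.Nonempty
  a : (Fin r → ℤ) → MvPolynomial (Fin r) K
  a_ne_zero : ∀ s ∈ S, a s ≠ 0
  f : MvPolynomial (Fin r) K

/-- `y` is a rational solution of the equation. -/
def Equation.IsSolution {K : Type*} [Field K] {r : ℕ} (E : Equation K r) (y : RatFunc K r) :
    Prop :=
  ∑ s ∈ E.S, algebraMap _ (RatFunc K r) (E.a s) * ratShift K s y =
    algebraMap _ (RatFunc K r) E.f

/-- `d` is a denominator bound of `E` with respect to the set `W ⊆ ℤ^r`: it is nonzero, and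
whenever `p / q` in lowest terms is a solution and `u` is an irreducible polynomial with
`Spread(u) ⊆ W`, every power of `u` that divides `q` divides `d`. -/
def Equation.IsDenominatorBound {K : Type*} [Field K] {r : ℕ} (E : Equation K r)
    (W : Set (Fin r → ℤ)) (d : MvPolynomial (Fin r) K) : Prop :=
  d ≠ 0 ∧
    ∀ p q : MvPolynomial (Fin r) K, q ≠ 0 → IsRelPrime p q →
      E.IsSolution (algebraMap _ (RatFunc K r) p / algebraMap _ (RatFunc K r) q) →
      ∀ u : MvPolynomial (Fin r) K, Irreducible u → spread u u ⊆ W →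
        ∀ m : ℕ, u ^ m ∣ q → u ^ m ∣ d

/-- `c` is a least common multiple of `a` and `b` (unique up to units). -/
def IsLcm {R : Type*} [CommRing R] (a b c : R) : Prop :=
  ∀ m, c ∣ m ↔ a ∣ m ∧ b ∣ m

/-- `Spread(u)` belongs to `U`. -/
def Equation.SpreadInU {K : Type*} [Field K] {r : ℕ} (E : Equation K r)
    (u : MvPolynomial (Fin r) K) : Prop :=
  ∃ W ∈ usefulModules E.S, (W : Set (Fin r → ℤ)) = spread u u

/-- `E.Run l d`: starting from `d = 1`, the loop body of the algorithm, executed for the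
polynomials of the list `l` (last entry first), can lead to the value `d`. In the iteration for
`u`, if `Spread(u) ∈ U`, some denominator bound `d₀` with respect to `Spread(u)` is computed and
`d` is replaced by `lcm(d, d₀)`; otherwise `d` is left unchanged. -/
inductive Equation.Run {K : Type*} [Field K] {r : ℕ} (E : Equation K r) :
    List (MvPolynomial (Fin r) K) → MvPolynomial (Fin r) K → Prop
  | start : E.Run [] 1
  | update (l : List (MvPolynomial (Fin r) K)) (u d d₀ d' : MvPolynomial (Fin r) K) :
      E.Run l d → E.SpreadInU u → E.IsDenominatorBound (spread u u) d₀ → IsLcm d d₀ d' →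
        E.Run (u :: l) d'
  | skip (l : List (MvPolynomial (Fin r) K)) (u d : MvPolynomial (Fin r) K) :
      E.Run l d → ¬ E.SpreadInU u → E.Run (u :: l) d

/-- The list `l` enumerates (in any order) the irreducible factors of the coefficients `a_q`, `q`
a corner point of the support, each of them being represented up to a unit at least once. -/
def Equation.EnumeratesCornerFactors {K : Type*} [Field K] {r : ℕ} (E : Equation K r)
    (l : List (MvPolynomial (Fin r) K)) : Prop :=
  (∀ u ∈ l, Irreducible u ∧ ∃ q, IsCornerPoint E.S q ∧ u ∣ E.a q) ∧
    ∀ q, IsCornerPoint E.S q → ∀ u, Irreducible u → u ∣ E.a q → ∃ u' ∈ l, Associated u u'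

/-- `d` is a possible output of the algorithm on input `E`. -/
def Equation.IsOutput {K : Type*} [Field K] {r : ℕ} (E : Equation K r)
    (d : MvPolynomial (Fin r) K) : Prop :=
  ∃ l, E.EnumeratesCornerFactors l ∧ E.Run l d

end PLDE

/-! Fix a solution `y` and an irreducible `u`, and look at the indices `i` for which `N^i y` has a
pole along `u`. For `v` orthogonal to `Spread(u)`, the values `i · v` on these indices are finitely
many (`finite_dot_not_integralAt`), so an extremal pole exists. If moreover `v` has a unique
minimizer `p` on the support, the equation shifted so that its term at `p` is a multiple of `N^i y`,
with `i` maximal, has no other pole along `u`; hence a shift of `u` divides `a_p`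
(`shift_dvd_of_maximal`). Shifting does not change the spread, so the algorithm meets a factor with
spread `Spread(u)`, and the bound computed there covers `u` itself.

Usefulness supplies such a `v`: perturbing the witness inside the orthogonal space of `W` makes its
minimizer and its maximizer unique (`exists_isVertex_of_mem_usefulModules`). Two unique extremes
bound the distance between poles uniformly, and iterated elimination turns this into a denominator
bound. For a union of modules, `Spread(u)` is a group covered by finitely many submodules, so it is
commensurable with a submodule of one of them and is itself useful. -/

namespace PLDE

/-! ### Shifts and the spread of an irreducible polynomial. -/

section Shift

variable {K : Type*} [Field K] {r : ℕ}

theorem shift_X (i : Fin r → ℤ) (k : Fin r) :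
    shift K i (X k) = X k + C ((i k : ℤ) : K) := by
  simp [shift, shiftHom]

theorem shift_shift (i j : Fin r → ℤ) (x : MvPolynomial (Fin r) K) :
    shift K i (shift K j x) = shift K (i + j) x := by
  have h : ((shift K i).toAlgHom.comp (shift K j).toAlgHom) = (shift K (i + j)).toAlgHom := by
    ext1 k
    simp [shift_X, add_assoc]
  exact DFunLike.congr_fun h x

theorem shift_zero (x : MvPolynomial (Fin r) K) : shift K 0 x = x := by
  apply (shift K (0 : Fin r → ℤ)).injective
  rw [shift_shift, add_zero]

theorem ratShift_algebraMap (i : Fin r → ℤ) (x : MvPolynomial (Fin r) K) :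
    ratShift K i (algebraMap _ (RatFunc K r) x) = algebraMap _ (RatFunc K r) (shift K i x) :=
  IsFractionRing.fieldEquivOfAlgEquiv_algebraMap _ _ _ _ _

theorem ratShift_ratShift (i j : Fin r → ℤ) (y : RatFunc K r) :
    ratShift K i (ratShift K j y) = ratShift K (i + j) y := by
  obtain ⟨a, b, -, rfl⟩ := IsFractionRing.div_surjective (MvPolynomial (Fin r) K) y
  simp only [map_div₀, ratShift_algebraMap, shift_shift]

theorem ratShift_zero (y : RatFunc K r) : ratShift K 0 y = y := by
  apply (ratShift K (0 : Fin r → ℤ)).injective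
  rw [ratShift_ratShift, add_zero]

theorem shift_dvd_iff {i : Fin r → ℤ} {u a : MvPolynomial (Fin r) K} :
    u ∣ shift K i a ↔ shift K (-i) u ∣ a := by
  rw [← map_dvd_iff (shift K (-i)) (a := u), shift_shift, neg_add_cancel, shift_zero]

theorem irreducible_shift {u : MvPolynomial (Fin r) K} (hu : Irreducible u) (i : Fin r → ℤ) :
    Irreducible (shift K i u) :=
  (MulEquiv.irreducible_iff (shift K i)).2 hu

theorem associated_shift {a b : MvPolynomial (Fin r) K} (h : Associated a b) (i : Fin r → ℤ) :
    Associated (shift K i a) (shift K i b) :=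
  h.map (shift K i)

/-- Shifts preserve irreducibility, so failing to be coprime means being associated; this makes the
spread a group. -/
theorem mem_spread_iff {u : MvPolynomial (Fin r) K} (hu : Irreducible u) {i : Fin r → ℤ} :
    i ∈ spread u u ↔ Associated u (shift K i u) := by
  rw [spread, Set.mem_ofPred_eq, hu.isRelPrime_iff_not_dvd, not_not]
  exact hu.dvd_irreducible_iff_associated (irreducible_shift hu i)

/-- The spread of an irreducible polynomial, as a submodule of `ℤ^r`. -/
def spreadModule (u : MvPolynomial (Fin r) K) (hu : Irreducible u) : Submodule ℤ (Fin r → ℤ) :=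
  AddSubgroup.toIntSubmodule
    { carrier := spread u u
      zero_mem' := by
        rw [mem_spread_iff hu, shift_zero]
      add_mem' := fun {i j} hi hj => by
        rw [mem_spread_iff hu] at hi hj ⊢
        rw [← shift_shift]
        exact hi.trans (associated_shift hj i)
      neg_mem' := fun {i} hi => by
        rw [mem_spread_iff hu] at hi ⊢
        have h := associated_shift hi (-i)
        rw [shift_shift, neg_add_cancel, shift_zero] at h
        exact h.symm }

theorem mem_spreadModule {u : MvPolynomial (Fin r) K} {hu : Irreducible u} {i : Fin r → ℤ} :
    i ∈ spreadModule u hu ↔ Associated u (shift K i u) :=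
  mem_spread_iff hu

theorem sub_mem_spreadModule {u : MvPolynomial (Fin r) K} {hu : Irreducible u} {i j : Fin r → ℤ}
    (h : Associated (shift K i u) (shift K j u)) : i - j ∈ spreadModule u hu := by
  have h' := associated_shift h (-j)
  rw [shift_shift, shift_shift, neg_add_cancel, shift_zero, neg_add_eq_sub] at h'
  exact mem_spreadModule.2 h'.symm

theorem spread_shift (u : MvPolynomial (Fin r) K) (hu : Irreducible u) (i : Fin r → ℤ) :
    spread (shift K i u) (shift K i u) = spread u u := by
  ext j
  rw [mem_spread_iff hu, mem_spread_iff (irreducible_shift hu i), shift_shift, add_comm,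
    ← shift_shift]
  refine ⟨fun h => ?_, fun h => associated_shift h i⟩
  have h' := associated_shift h (-i)
  simpa only [shift_shift, neg_add_cancel, shift_zero, neg_add_cancel_left] using h'

theorem spread_congr {u u' : MvPolynomial (Fin r) K} (hu : Irreducible u) (h : Associated u u') :
    spread u u = spread u' u' := by
  ext j
  rw [mem_spread_iff hu, mem_spread_iff (h.irreducible hu)]
  exact ⟨fun k => (h.symm.trans k).trans (associated_shift h j),
    fun k => (h.trans k).trans (associated_shift h j).symm⟩

end Shift

/-! ### Rational functions without a pole along `u`. -/

section IntegralAt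

variable {K : Type*} [Field K] {r : ℕ}

/-- The rational function `z` has no pole along `u`: it has a denominator not divisible by `u`. -/
def IntegralAt (u : MvPolynomial (Fin r) K) (z : RatFunc K r) : Prop :=
  ∃ a b : MvPolynomial (Fin r) K, ¬ u ∣ b ∧ algebraMap _ (RatFunc K r) b * z = algebraMap _ (RatFunc K r) a

variable {u : MvPolynomial (Fin r) K}

theorem integralAt_algebraMap (hu : Irreducible u) (a : MvPolynomial (Fin r) K) :
    IntegralAt u (algebraMap _ (RatFunc K r) a) :=
  ⟨a, 1, fun h => hu.not_isUnit (isUnit_of_dvd_one h), by rw [map_one, one_mul]⟩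

theorem IntegralAt.mul (hu : Irreducible u) {y z : RatFunc K r} (hy : IntegralAt u y)
    (hz : IntegralAt u z) : IntegralAt u (y * z) := by
  obtain ⟨a, b, hb, h⟩ := hy
  obtain ⟨c, d, hd, h'⟩ := hz
  refine ⟨a * c, b * d, fun hbd => (hu.prime.dvd_or_dvd hbd).elim hb hd, ?_⟩
  rw [map_mul, map_mul, ← h, ← h']
  ring

theorem IntegralAt.add (hu : Irreducible u) {y z : RatFunc K r} (hy : IntegralAt u y)
    (hz : IntegralAt u z) : IntegralAt u (y + z) := by
  obtain ⟨a, b, hb, h⟩ := hy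
  obtain ⟨c, d, hd, h'⟩ := hz
  refine ⟨d * a + b * c, b * d, fun hbd => (hu.prime.dvd_or_dvd hbd).elim hb hd, ?_⟩
  simp only [map_mul, map_add, ← h, ← h']
  ring

theorem IntegralAt.sub (hu : Irreducible u) {y z : RatFunc K r} (hy : IntegralAt u y)
    (hz : IntegralAt u z) : IntegralAt u (y - z) := by
  have h := hy.add hu ((integralAt_algebraMap hu (-1)).mul hu hz)
  rwa [map_neg, map_one, neg_one_mul, ← sub_eq_add_neg] at h

theorem IntegralAt.sum (hu : Irreducible u) {ι : Type*} {s : Finset ι} {g : ι → RatFunc K r}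
    (h : ∀ i ∈ s, IntegralAt u (g i)) : IntegralAt u (∑ i ∈ s, g i) := by
  refine Finset.sum_induction g (IntegralAt u) (fun _ _ hy hz => hy.add hu hz) ?_ h
  simpa using integralAt_algebraMap hu 0

theorem IntegralAt.of_mul_left (hu : Irreducible u) {b : MvPolynomial (Fin r) K} (hb : ¬ u ∣ b)
    {z : RatFunc K r} (h : IntegralAt u (algebraMap _ (RatFunc K r) b * z)) : IntegralAt u z := by
  obtain ⟨a, c, hc, h⟩ := h
  exact ⟨a, c * b, fun hcb => (hu.prime.dvd_or_dvd hcb).elim hc hb, by rw [map_mul, mul_assoc, h]⟩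

theorem integralAt_shift_ratShift {z : RatFunc K r} (h : IntegralAt u z) (i : Fin r → ℤ) :
    IntegralAt (shift K i u) (ratShift K i z) := by
  obtain ⟨a, b, hb, h⟩ := h
  refine ⟨shift K i a, shift K i b, fun hd => hb ((map_dvd_iff (shift K i)).1 hd), ?_⟩
  rw [← ratShift_algebraMap, ← ratShift_algebraMap, ← map_mul, h]

theorem integralAt_ratShift_iff {z : RatFunc K r} {i : Fin r → ℤ} :
    IntegralAt u (ratShift K i z) ↔ IntegralAt (shift K (-i) u) z := by
  refine ⟨fun h => ?_, fun h => ?_⟩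
  · simpa only [ratShift_ratShift, neg_add_cancel, ratShift_zero] using integralAt_shift_ratShift h (-i)
  · simpa only [shift_shift, add_neg_cancel, shift_zero] using integralAt_shift_ratShift h i

theorem integralAt_div {p q : MvPolynomial (Fin r) K} (hq : q ≠ 0) (h : ¬ u ∣ q) :
    IntegralAt u (algebraMap _ (RatFunc K r) p / algebraMap _ (RatFunc K r) q) := by
  refine ⟨p, q, h, mul_div_cancel₀ _ ?_⟩
  rwa [Ne, FaithfulSMul.algebraMap_eq_zero_iff]

/-- If multiplication by `A` clears the pole of `p / q` along `u`, then `A` is divisible by every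
power of `u` dividing `q`. -/
theorem pow_dvd_of_integralAt (hu : Irreducible u) {p q A : MvPolynomial (Fin r) K} (hq : q ≠ 0)
    (hpq : IsRelPrime p q)
    (h : IntegralAt u (algebraMap _ (RatFunc K r) A *
      (algebraMap _ (RatFunc K r) p / algebraMap _ (RatFunc K r) q)))
    {m : ℕ} (hm : u ^ m ∣ q) : u ^ m ∣ A := by
  obtain ⟨a, b, hb, h⟩ := h
  rcases m.eq_zero_or_pos with rfl | hm0
  · simp
  have huq : u ∣ q := (dvd_pow_self u hm0.ne').trans hm
  have hup : ¬ u ∣ p := fun hup => hu.not_isUnit (hpq hup huq)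
  have hq' : algebraMap _ (RatFunc K r) q ≠ 0 := by
    rwa [Ne, FaithfulSMul.algebraMap_eq_zero_iff]
  have key : b * A * p = a * q := by
    apply IsFractionRing.injective (MvPolynomial (Fin r) K) (RatFunc K r)
    rw [map_mul, map_mul, map_mul, ← h]
    field_simp
  have h1 : u ^ m ∣ p * (b * A) := by
    rw [mul_comm, key]
    exact hm.mul_left a
  exact hu.prime.pow_dvd_of_dvd_mul_left m hb (hu.prime.pow_dvd_of_dvd_mul_left m hup h1)

end IntegralAt

/-! ### Bilinearity of the inner product. -/

section Dot

variable {r : ℕ} (x y : Fin r → ℤ) (v w : Fin r → ℝ)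

theorem dot_add : dot (x + y) v = dot x v + dot y v := by
  simp [dot, add_mul, Finset.sum_add_distrib]

theorem dot_neg : dot (-x) v = -dot x v := by
  simp [dot]

theorem dot_sub : dot (x - y) v = dot x v - dot y v := by
  rw [sub_eq_add_neg, dot_add, dot_neg, ← sub_eq_add_neg]

theorem dot_zero : dot (0 : Fin r → ℤ) v = 0 := by
  simp [dot]

theorem dot_zsmul (k : ℤ) : dot (k • x) v = k * dot x v := by
  simp [dot, Finset.mul_sum, mul_assoc]

theorem dot_add_right : dot x (v + w) = dot x v + dot x w := by
  simp [dot, mul_add, Finset.sum_add_distrib]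

theorem dot_smul_right (c : ℝ) : dot x (c • v) = c * dot x v := by
  simp only [dot, Pi.smul_apply, smul_eq_mul, Finset.mul_sum]
  exact Finset.sum_congr rfl fun _ _ => by ring

theorem dot_neg_right : dot x (-v) = -dot x v := by
  simp [dot]

end Dot

/-! ### Perturbing witnesses to unique extremal points; submodules covered by useful ones. -/

section Vertices

variable {r : ℕ}

/-- The lattice point `p` is the unique minimizer of `v` on `S`. -/
def IsVertex (S : Finset (Fin r → ℤ)) (p : Fin r → ℤ) (v : Fin r → ℝ) : Prop :=
  p ∈ S ∧ ∀ s ∈ S, s ≠ p → 0 < dot (s - p) v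

theorem IsVertex.isCornerPoint {S : Finset (Fin r → ℤ)} {p : Fin r → ℤ} {v : Fin r → ℝ}
    (h : IsVertex S p v) : IsCornerPoint S p :=
  ⟨h.1, v, h.2⟩

theorem Orthogonal.neg {W : Submodule ℤ (Fin r → ℤ)} {v : Fin r → ℝ} (h : Orthogonal W v) :
    Orthogonal W (-v) := fun w hw => by rw [dot_neg_right, h w hw, neg_zero]

theorem Orthogonal.mono {W W' : Submodule ℤ (Fin r → ℤ)} {v : Fin r → ℝ} (h : Orthogonal W v)
    (hW : W' ≤ W) : Orthogonal W' v := fun w hw => h w (hW hw)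

/-- The real vectors orthogonal to a submodule of `ℤ^r`. -/
def orthogonalSpace (W : Submodule ℤ (Fin r → ℤ)) : Submodule ℝ (Fin r → ℝ) where
  carrier := {v | Orthogonal W v}
  zero_mem' := fun w _ => by simp [dot]
  add_mem' := fun {v v'} hv hv' w hw => by rw [dot_add_right, hv w hw, hv' w hw, add_zero]
  smul_mem' := fun c v hv w hw => by rw [dot_smul_right, hv w hw, mul_zero]

theorem exists_orthogonal_dot_ne_zero (W : Submodule ℤ (Fin r → ℤ)) {x : Fin r → ℤ}
    (hx : ∀ k : ℤ, k ≠ 0 → k • x ∉ W) : ∃ w, Orthogonal W w ∧ dot x w ≠ 0 := by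
  -- The rational span of `W`, described by clearing denominators. A functional vanishing on it but
  -- not at `x` yields `w`.
  let P : Submodule ℚ (Fin r → ℚ) :=
    { carrier := {z | ∃ k : ℤ, k ≠ 0 ∧ ∃ w ∈ W, ∀ j, (k : ℚ) * z j = (w j : ℤ)}
      zero_mem' := ⟨1, one_ne_zero, 0, W.zero_mem, by simp⟩
      add_mem' := by
        rintro z z' ⟨k, hk, w, hw, h⟩ ⟨k', hk', w', hw', h'⟩
        refine ⟨k * k', mul_ne_zero hk hk', k' • w + k • w',
          W.add_mem (W.smul_mem _ hw) (W.smul_mem _ hw'), fun j => ?_⟩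
        simp only [Pi.add_apply, Pi.smul_apply, smul_eq_mul, Int.cast_add, Int.cast_mul, ← h, ← h']
        ring
      smul_mem' := by
        rintro c z ⟨k, hk, w, hw, h⟩
        refine ⟨c.den * k, mul_ne_zero (by exact_mod_cast c.den_ne_zero) hk, c.num • w,
          W.smul_mem _ hw, fun j => ?_⟩
        simp only [Pi.smul_apply, smul_eq_mul, Int.cast_mul, ← h, Int.cast_natCast]
        calc (c.den * k * (c * z j) : ℚ) = (c * c.den) * (k * z j) := by ring
          _ = c.num * (k * z j) := by rw [Rat.mul_den_eq_num] }
  have hxP : (fun j => (x j : ℚ)) ∉ P := by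
    rintro ⟨k, hk, w, hw, h⟩
    refine hx k hk ?_
    convert hw
    ext j
    have hj := h j
    simp only at hj
    rw [Pi.smul_apply, smul_eq_mul]
    exact_mod_cast hj
  obtain ⟨f, hf, hP⟩ := Submodule.exists_le_ker_of_notMem hxP
  have hdot : ∀ z : Fin r → ℤ,
      dot z (fun j => ((f (Pi.single j 1) : ℚ) : ℝ)) = ((f fun j => (z j : ℚ) : ℚ) : ℝ) := by
    intro z
    rw [f.pi_apply_eq_sum_univ]
    simp only [dot, smul_eq_mul, Rat.cast_sum, Rat.cast_mul, Rat.cast_intCast]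
    refine Finset.sum_congr rfl fun j _ => ?_
    congr 4
    ext k
    simp [Pi.single_apply, eq_comm]
  refine ⟨fun j => ((f (Pi.single j 1) : ℚ) : ℝ), fun w hw => ?_, ?_⟩
  · rw [hdot, hP ⟨1, one_ne_zero, w, hw, by simp⟩, Rat.cast_zero]
  · rw [hdot]
    exact_mod_cast hf

/-- Finitely many lattice vectors, none of which has a nonzero multiple in `W`, are
simultaneously non-orthogonal to some vector orthogonal to `W`. -/
theorem exists_orthogonal_forall_dot_ne_zero (W : Submodule ℤ (Fin r → ℤ))
    (T : Finset (Fin r → ℤ)) (hT : ∀ x ∈ T, ∀ k : ℤ, k ≠ 0 → k • x ∉ W) :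
    ∃ w, Orthogonal W w ∧ ∀ x ∈ T, dot x w ≠ 0 := by
  classical
  let H : (Fin r → ℤ) → Submodule ℝ (orthogonalSpace W) := fun x =>
    { carrier := {w | dot x w = 0}
      zero_mem' := by simp [dot]
      add_mem' := fun {v v'} hv hv' => by
        simp only [Set.mem_ofPred_eq, Submodule.coe_add] at *
        rw [dot_add_right, hv, hv', add_zero]
      smul_mem' := fun c v hv => by
        simp only [Set.mem_ofPred_eq, Submodule.coe_smul] at *
        rw [dot_smul_right, hv, mul_zero] }
  have htop : ⊤ ∉ T.image H := by
    intro h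
    obtain ⟨x, hx, hxt⟩ := Finset.mem_image.1 h
    obtain ⟨w, hw, hxw⟩ := exists_orthogonal_dot_ne_zero W (hT x hx)
    have : (⟨w, hw⟩ : orthogonalSpace W) ∈ H x := by rw [hxt]; trivial
    exact hxw this
  -- A real vector space is not a finite union of proper subspaces.
  obtain ⟨w, hw⟩ := (Set.ne_univ_iff_exists_notMem _).1 (Subspace.biUnion_ne_univ_of_top_notMem htop)
  refine ⟨w, w.2, fun x hx h0 => hw ?_⟩
  exact Set.mem_biUnion (Finset.mem_coe.2 (Finset.mem_image_of_mem H hx)) h0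

open Filter Topology in
/-- If `v` is minimal on `S` along the face through `p`, and `w` is injective on that face, then
all small perturbations of `v` in the direction of `w` have a common unique minimizer. -/
theorem exists_isVertex_perturbation {S : Finset (Fin r → ℤ)} {p : Fin r → ℤ} {v w : Fin r → ℝ}
    (hp : p ∈ S) (hv : ∀ s ∈ S, 0 ≤ dot (s - p) v)
    (hw : ∀ s ∈ S, ∀ t ∈ S, dot (s - p) v = 0 → dot (t - p) v = 0 → s ≠ t → dot (s - t) w ≠ 0) :
    ∃ p', ∀ᶠ ε : ℝ in 𝓝[>] 0, IsVertex S p' (v + ε • w) := by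
  classical
  -- For small `ε` the `w`-values decide on the face of `v`, while points off the face stay strictly
  -- above it by continuity.
  obtain ⟨p', hp', hmin⟩ := (S.filter fun s => dot (s - p) v = 0).exists_min_image
    (fun s => dot s w) ⟨p, by simp [hp, dot_zero]⟩
  rw [Finset.mem_filter] at hp'
  refine ⟨p', ?_⟩
  have hall : ∀ᶠ ε : ℝ in 𝓝[>] 0, ∀ s ∈ S, s ≠ p' → 0 < dot (s - p') (v + ε • w) := by
    refine (Filter.eventually_all_finset S).2 fun s hs => ?_
    simp only [dot_add_right, dot_smul_right]
    have hsp : dot (s - p') v = dot (s - p) v := by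
      have := hp'.2
      rw [dot_sub] at this ⊢
      rw [dot_sub]
      linarith
    rcases (hv s hs).eq_or_lt with h0 | hpos
    · filter_upwards [self_mem_nhdsWithin] with ε hε hne
      have h1 := hmin s (Finset.mem_filter.2 ⟨hs, h0.symm⟩)
      have h2 := hw s hs p' hp'.1 h0.symm hp'.2 hne
      have h3 : 0 < dot (s - p') w := by
        refine lt_of_le_of_ne ?_ h2.symm
        rw [dot_sub]
        linarith
      rw [hsp, ← h0, zero_add]
      exact mul_pos hε h3
    · have hc : Continuous fun ε : ℝ => dot (s - p') v + ε * dot (s - p') w := by fun_prop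
      have h1 : ∀ᶠ ε : ℝ in 𝓝 0, 0 < dot (s - p') v + ε * dot (s - p') w :=
        hc.continuousAt.eventually (lt_mem_nhds (by simpa [hsp] using hpos))
      exact (h1.filter_mono nhdsWithin_le_nhds).mono fun ε h _ => h
  exact hall.mono fun ε h => ⟨hp'.1, h⟩

/-- A useful submodule is orthogonal to a vector having a unique minimizer and a unique maximizer
on the support. -/
theorem exists_isVertex_of_mem_usefulModules {S : Finset (Fin r → ℤ)}
    {W : Submodule ℤ (Fin r → ℤ)} (hW : W ∈ usefulModules S) :
    ∃ v p p', Orthogonal W v ∧ IsVertex S p v ∧ IsVertex S p' (-v) := by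
  classical
  obtain ⟨p, p', hp, hp', v, hv, hWv, hsp, hsp'⟩ := hW
  -- Separation puts all differences within both faces into this finite set, so one `w` serves both.
  obtain ⟨w, hWw, hw⟩ := exists_orthogonal_forall_dot_ne_zero W
    (((S ×ˢ S).image fun z => z.1 - z.2).filter fun x => ∀ k : ℤ, k ≠ 0 → k • x ∉ W)
    fun x hx => (Finset.mem_filter.1 hx).2
  have hsep : ∀ q, SeparatedOnFace S W q v → ∀ s ∈ S, ∀ t ∈ S, dot (s - q) v = 0 →
      dot (t - q) v = 0 → s ≠ t → dot (s - t) w ≠ 0 := by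
    intro q hq s hs t ht h h' hne
    refine hw _ (Finset.mem_filter.2
      ⟨Finset.mem_image.2 ⟨(s, t), Finset.mk_mem_product hs ht, rfl⟩, fun k hk hmem => ?_⟩)
    exact hne (hq s hs t ht h h' ⟨k, hk, hmem⟩)
  obtain ⟨q, hq⟩ := exists_isVertex_perturbation hp.1 (fun s hs => (hv s hs).1) (hsep p hsp)
  obtain ⟨q', hq'⟩ := exists_isVertex_perturbation (v := -v) (w := -w) hp'.1
    (fun s hs => by
      have := (hv s hs).2
      rw [dot_neg_right, ← dot_neg, neg_sub]
      exact this)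
    (fun s hs t ht h h' hne => by
      rw [dot_neg_right, neg_eq_zero] at h h'
      rw [dot_neg_right, neg_ne_zero]
      exact hsep p' hsp' s hs t ht h h' hne)
  obtain ⟨ε, h, h'⟩ := (hq.and hq').exists
  refine ⟨v + ε • w, q, q', (orthogonalSpace W).add_mem hWv ((orthogonalSpace W).smul_mem ε hWw),
    h, ?_⟩
  rwa [neg_add, ← smul_neg]

/-- A submodule of `ℤ^r` covered by finitely many useful submodules is useful. -/
theorem mem_usefulModules_of_subset_biUnion {S : Finset (Fin r → ℤ)}
    {W : Submodule ℤ (Fin r → ℤ)} {Ws : Set (Submodule ℤ (Fin r → ℤ))} (hfin : Ws.Finite)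
    (hWs : Ws ⊆ usefulModules S)
    (hcov : (W : Set (Fin r → ℤ)) ⊆ ⋃ V ∈ Ws, (V : Set (Fin r → ℤ))) : W ∈ usefulModules S := by
  classical
  -- B. H. Neumann's covering lemma: some `V` meets `W` in finite index, so the index multiplies `W`
  -- into `V`.
  obtain ⟨V, hV, hidx⟩ := Submodule.exists_finiteIndex_of_cover (R := ℤ) (M := W)
    (s := hfin.toFinset) (p := fun V => V.comap W.subtype) (by
      refine Set.eq_univ_of_forall fun x => ?_
      obtain ⟨V, hV, hx⟩ := Set.mem_iUnion₂.1 (hcov x.2)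
      exact Set.mem_biUnion (Finset.mem_coe.2 (hfin.mem_toFinset.2 hV)) hx)
  have hV' := hWs (hfin.mem_toFinset.1 hV)
  have hmul : ∃ k : ℤ, k ≠ 0 ∧ ∀ x ∈ W, k • x ∈ V := by
    refine ⟨((V.comap W.subtype).toAddSubgroup.index : ℕ), by exact_mod_cast hidx.index_ne_zero,
      fun x hx => ?_⟩
    have h := AddSubgroup.nsmul_index_mem (V.comap W.subtype).toAddSubgroup (⟨x, hx⟩ : W)
    rw [natCast_zsmul]
    exact h
  obtain ⟨k, hk, hkV⟩ := hmul
  obtain ⟨p, p', hp, hp', v, hv, hVv, hsp, hsp'⟩ := hV'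
  refine ⟨p, p', hp, hp', v, hv, fun w hw => ?_, ?_, ?_⟩
  · have h := hVv _ (hkV w hw)
    rw [dot_zsmul] at h
    exact (mul_eq_zero.1 h).resolve_left (by exact_mod_cast hk)
  · rintro s hs t ht h h' ⟨l, hl, hlW⟩
    exact hsp s hs t ht h h' ⟨k * l, mul_ne_zero hk hl, by rw [mul_smul]; exact hkV _ hlW⟩
  · rintro s hs t ht h h' ⟨l, hl, hlW⟩
    exact hsp' s hs t ht h h' ⟨k * l, mul_ne_zero hk hl, by rw [mul_smul]; exact hkV _ hlW⟩

end Vertices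

/-! ### Isolating one term of the equation. -/

section Solutions

variable {K : Type*} [Field K] {r : ℕ} {E : Equation K r} {y : RatFunc K r}

/-- Solving the equation for the term at `p`: if a polynomial `B` clears the poles along `u` of all
the other shifts, then `B` times the coefficient clears those of the term at `p`. -/
theorem Equation.IsSolution.integralAt (hy : E.IsSolution y) {u : MvPolynomial (Fin r) K}
    (hu : Irreducible u) (B : MvPolynomial (Fin r) K) {p : Fin r → ℤ} (hp : p ∈ E.S)
    (i : Fin r → ℤ)
    (h : ∀ s ∈ E.S, s ≠ p →
      IntegralAt u (algebraMap _ (RatFunc K r) B * ratShift K (i + (s - p)) y)) :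
    IntegralAt u
      (algebraMap _ (RatFunc K r) (B * shift K (i - p) (E.a p)) * ratShift K i y) := by
  classical
  have heq := congrArg (ratShift K (i - p)) hy
  simp only [map_sum, map_mul, ratShift_algebraMap, ratShift_ratShift] at heq
  rw [← Finset.add_sum_erase _ _ hp, sub_add_cancel] at heq
  rw [map_mul, mul_assoc, eq_sub_of_add_eq heq, mul_sub, Finset.mul_sum]
  refine IntegralAt.sub hu ((integralAt_algebraMap hu _).mul hu (integralAt_algebraMap hu _))
    (IntegralAt.sum hu fun s hs => ?_)
  have hs' := h s (Finset.mem_of_mem_erase hs) (Finset.ne_of_mem_erase hs)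
  rw [mul_left_comm, show i - p + s = i + (s - p) by abel]
  exact (integralAt_algebraMap hu _).mul hu hs'

/-- If the pole of `N^i y` along `u` is extremal in the direction of `v`, then `u` divides the
shifted coefficient at the vertex of the support minimizing `v`. -/
theorem Equation.IsSolution.shift_dvd_of_maximal (hy : E.IsSolution y)
    {u : MvPolynomial (Fin r) K} (hu : Irreducible u) {p : Fin r → ℤ} {v : Fin r → ℝ}
    (hp : IsVertex E.S p v) {i : Fin r → ℤ} (hi : ¬ IntegralAt u (ratShift K i y))
    (hmax : ∀ j, ¬ IntegralAt u (ratShift K j y) → dot j v ≤ dot i v) :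
    shift K (p - i) u ∣ E.a p := by
  by_contra hnd
  rw [← neg_sub i p, ← shift_dvd_iff] at hnd
  refine hi (IntegralAt.of_mul_left hu hnd ?_)
  have h := hy.integralAt hu 1 hp.1 i fun s hs hne => by
    rw [map_one, one_mul]
    by_contra hc
    have h1 := hmax _ hc
    have h2 := hp.2 s hs hne
    rw [dot_add] at h1
    linarith
  rwa [one_mul] at h

end Solutions

/-! ### Bounded distance between poles and existence of denominator bounds. -/

section Dispersion

variable {K : Type*} [Field K] {r : ℕ}

/-- In a direction orthogonal to the spreads, the shift distances between factors of `a` and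
factors of `b` take finitely many values only. -/
theorem finite_dot_shift_dvd {a b : MvPolynomial (Fin r) K} (ha : a ≠ 0) (hb : b ≠ 0)
    (v : Fin r → ℝ) :
    {x : ℝ | ∃ (g : MvPolynomial (Fin r) K) (hg : Irreducible g) (j : Fin r → ℤ),
      Orthogonal (spreadModule g hg) v ∧ g ∣ a ∧ shift K j g ∣ b ∧ dot j v = x}.Finite := by
  classical
  let T : Set ℝ := {x : ℝ | ∃ (g : MvPolynomial (Fin r) K) (hg : Irreducible g) (j : Fin r → ℤ),
      Orthogonal (spreadModule g hg) v ∧ g ∣ a ∧ shift K j g ∣ b ∧ dot j v = x}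
  let A := (UniqueFactorizationMonoid.factors a).toFinset
  let B := (UniqueFactorizationMonoid.factors b).toFinset
  have key : ∀ x : T, ∃ z : A × B, ∃ (g : MvPolynomial (Fin r) K) (hg : Irreducible g)
      (j : Fin r → ℤ), Orthogonal (spreadModule g hg) v ∧ dot j v = x ∧
        Associated g z.1 ∧ Associated (shift K j g) z.2 := by
    rintro ⟨x, g, hg, j, hv, hga, hgb, hx⟩
    obtain ⟨c, hc, hgc⟩ := UniqueFactorizationMonoid.exists_mem_factors_of_dvd ha hg hga
    obtain ⟨d, hd, hgd⟩ :=
      UniqueFactorizationMonoid.exists_mem_factors_of_dvd hb (irreducible_shift hg j) hgb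
    exact ⟨(⟨c, Multiset.mem_toFinset.2 hc⟩, ⟨d, Multiset.mem_toFinset.2 hd⟩),
      g, hg, j, hv, hx, hgc, hgd⟩
  choose F hF using key
  -- Equal pairs of factors force `j - j'` into the spread of `g`, to which `v` is orthogonal.
  have hinj : Function.Injective F := by
    intro x x' hxx
    obtain ⟨g, hg, j, hv, hx, h1, h2⟩ := hF x
    obtain ⟨g', hg', j', -, hx', h1', h2'⟩ := hF x'
    rw [← hxx] at h1' h2'
    have h3 : Associated (shift K j g) (shift K j' g) :=
      (h2.trans h2'.symm).trans (associated_shift (h1'.trans h1.symm) j')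
    have h4 := hv _ (sub_mem_spreadModule (hu := hg) h3)
    rw [dot_sub, sub_eq_zero, hx, hx'] at h4
    exact Subtype.ext h4
  exact Set.finite_coe_iff.1 (Finite.of_injective F hinj)

theorem finite_dot_not_integralAt (y : RatFunc K r) {u : MvPolynomial (Fin r) K}
    (hu : Irreducible u) {v : Fin r → ℝ} (hv : Orthogonal (spreadModule u hu) v) :
    ((fun i => dot i v) '' {i | ¬ IntegralAt u (ratShift K i y)}).Finite := by
  obtain ⟨a, b, hb, rfl⟩ := IsFractionRing.div_surjective (MvPolynomial (Fin r) K) y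
  have hb0 : b ≠ 0 := nonZeroDivisors.ne_zero hb
  refine ((finite_dot_shift_dvd (a := u) hu.ne_zero hb0 v).image Neg.neg).subset ?_
  rintro _ ⟨i, hi, rfl⟩
  refine ⟨-dot i v, ⟨u, hu, -i, hv, dvd_rfl, ?_, dot_neg i v⟩, neg_neg _⟩
  by_contra hnd
  exact hi (integralAt_ratShift_iff.2 (integralAt_div hb0 hnd))

theorem exists_maximal_not_integralAt {y : RatFunc K r} {u : MvPolynomial (Fin r) K}
    (hu : Irreducible u) {v : Fin r → ℝ} (hv : Orthogonal (spreadModule u hu) v)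
    (hy : ¬ IntegralAt u y) :
    ∃ i, ¬ IntegralAt u (ratShift K i y) ∧
      ∀ j, ¬ IntegralAt u (ratShift K j y) → dot j v ≤ dot i v := by
  obtain ⟨i, hi, hmax⟩ := Set.exists_max_image _ id (finite_dot_not_integralAt y hu hv)
    ⟨_, 0, by simpa [ratShift_zero] using hy, rfl⟩
  obtain ⟨i, hi, rfl⟩ := hi
  exact ⟨i, hi, fun j hj => hmax _ ⟨j, hj, rfl⟩⟩

variable {E : Equation K r}

/-- In a direction orthogonal to `W` with unique extremal points of the support, the distance
between poles of a solution along shifts of a polynomial with spread in `W` is bounded uniformly. -/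
theorem Equation.exists_bound_not_integralAt {W : Submodule ℤ (Fin r → ℤ)} {v : Fin r → ℝ}
    {p p' : Fin r → ℤ} (hv : Orthogonal W v) (hp : IsVertex E.S p v)
    (hp' : IsVertex E.S p' (-v)) :
    ∃ c : ℝ, ∀ y, E.IsSolution y → ∀ u, Irreducible u → spread u u ⊆ W → ¬ IntegralAt u y →
      ∀ i, ¬ IntegralAt u (ratShift K i y) → dot i v < c := by
  obtain ⟨c, hc⟩ := (finite_dot_shift_dvd (E.a_ne_zero p hp.1) (E.a_ne_zero p' hp'.1) v).bddAbove
  -- With `k` maximal and `l` minimal, `(p' - l - (p - k)) · v ≤ c`. Since `y` has a pole at index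
  -- `0`, `l · v ≤ 0`, which bounds `k · v`; the `1` makes the inequality strict.
  refine ⟨c + dot p v - dot p' v + 1, fun y hy u hu hW h0 i hi => ?_⟩
  have hvu : Orthogonal (spreadModule u hu) v := hv.mono hW
  obtain ⟨k, hk, hmax⟩ := exists_maximal_not_integralAt hu hvu h0
  obtain ⟨l, hl, hmin⟩ := exists_maximal_not_integralAt hu hvu.neg h0
  have h1 := hy.shift_dvd_of_maximal hu hp hk hmax
  have h2 := hy.shift_dvd_of_maximal hu hp' hl hmin
  have hg := irreducible_shift hu (p - k)
  have hvg : Orthogonal (spreadModule _ hg) v :=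
    hvu.mono (spread_shift u hu (p - k)).le
  have h3 := hc ⟨shift K (p - k) u, hg, p' - l - (p - k), hvg, h1,
    by rwa [shift_shift, sub_add_cancel], rfl⟩
  have h4 := hmax i hi
  have h5 := hmin 0 (by rwa [ratShift_zero])
  simp only [dot_sub, dot_neg_right, dot_zero] at h3 h5
  linarith

/-- Iterated elimination: a universal multiplier `A` clears the pole along `u` of every solution
whose shifts of distance at least `c` have no pole there. -/
theorem Equation.exists_multiplier {p : Fin r → ℤ} {v : Fin r → ℝ} (hp : IsVertex E.S p v)
    (c : ℝ) :
    ∃ A : MvPolynomial (Fin r) K, A ≠ 0 ∧ ∀ y, E.IsSolution y → ∀ u, Irreducible u →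
      (∀ i, c ≤ dot i v → IntegralAt u (ratShift K i y)) →
        IntegralAt u (algebraMap _ (RatFunc K r) A * y) := by
  classical
  -- Passing from `p` to another support point gains at least `δ`, so each elimination lowers the
  -- threshold by `δ`.
  obtain ⟨δ, hδ, hδS⟩ : ∃ δ : ℝ, 0 < δ ∧ ∀ s ∈ E.S, s ≠ p → δ ≤ dot (s - p) v := by
    have h : ∀ s ∈ E.S.erase p, 0 < dot (s - p) v := fun s hs =>
      hp.2 s (Finset.mem_of_mem_erase hs) (Finset.ne_of_mem_erase hs)
    rcases (E.S.erase p).eq_empty_or_nonempty with he | hne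
    · exact ⟨1, one_pos, fun s hs hne => absurd (Finset.mem_erase.2 ⟨hne, hs⟩) (by simp [he])⟩
    · obtain ⟨t, ht, hmin⟩ := (E.S.erase p).exists_min_image (fun s => dot (s - p) v) hne
      exact ⟨_, h t ht, fun s hs hne => hmin s (Finset.mem_erase.2 ⟨hne, hs⟩)⟩
  suffices H : ∀ n : ℕ, ∃ A : MvPolynomial (Fin r) K, A ≠ 0 ∧ ∀ y, E.IsSolution y →
      ∀ u, Irreducible u → (∀ i, n * δ ≤ dot i v → IntegralAt u (ratShift K i y)) →
        IntegralAt u (algebraMap _ (RatFunc K r) A * y) by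
    obtain ⟨n, hn⟩ := exists_nat_ge (c / δ)
    obtain ⟨A, hA, h⟩ := H n
    exact ⟨A, hA, fun y hy u hu hi => h y hy u hu fun i hni =>
      hi i (((div_le_iff₀ hδ).1 hn).trans hni)⟩
  intro n
  induction n with
  | zero =>
    refine ⟨1, one_ne_zero, fun y _ u _ h => ?_⟩
    have h0 := h 0 (by simp [dot_zero])
    rw [ratShift_zero] at h0
    rwa [map_one, one_mul]
  | succ n ih =>
    obtain ⟨A, hA, h⟩ := ih
    refine ⟨(∏ s ∈ E.S.erase p, shift K (s - p) A) * shift K (0 - p) (E.a p),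
      mul_ne_zero (Finset.prod_ne_zero_iff.2 fun s _ => ?_) ?_, fun y hy u hu hi => ?_⟩
    · rwa [Ne, EmbeddingLike.map_eq_zero_iff]
    · rw [Ne, EmbeddingLike.map_eq_zero_iff]
      exact E.a_ne_zero p hp.1
    have key := hy.integralAt hu (∏ s ∈ E.S.erase p, shift K (s - p) A) hp.1 0
      fun s hs hne => by
        rw [zero_add, ← Finset.mul_prod_erase _ _ (Finset.mem_erase.2 ⟨hne, hs⟩), map_mul,
          mul_right_comm, ← ratShift_algebraMap, ← map_mul, mul_comm]
        refine (integralAt_algebraMap hu _).mul hu (integralAt_ratShift_iff.2 ?_)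
        -- The induction hypothesis is applied to a shift of `u`, so the multiplier has to be
        -- uniform in `u`.
        refine h y hy _ (irreducible_shift hu _) fun i hni => ?_
        rw [← integralAt_ratShift_iff, ratShift_ratShift]
        refine hi _ ?_
        have := hδS s hs hne
        rw [dot_add]
        push_cast
        linarith
    rwa [ratShift_zero] at key

theorem Equation.exists_isDenominatorBound {W : Submodule ℤ (Fin r → ℤ)}
    (hW : W ∈ usefulModules E.S) : ∃ d, E.IsDenominatorBound W d := by
  obtain ⟨v, p, p', hv, hp, hp'⟩ := exists_isVertex_of_mem_usefulModules hW
  obtain ⟨c, hc⟩ := E.exists_bound_not_integralAt hv hp hp'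
  obtain ⟨A, hA, h⟩ := E.exists_multiplier hp c
  refine ⟨A, hA, fun a q hq haq hy u hu huW m hm => pow_dvd_of_integralAt hu hq haq ?_ hm⟩
  by_cases h0 : IntegralAt u
      (algebraMap _ (RatFunc K r) a / algebraMap _ (RatFunc K r) q)
  · exact (integralAt_algebraMap hu A).mul hu h0
  · refine h _ hy u hu fun i hi => ?_
    by_contra hni
    exact absurd (hc _ hy u hu huW h0 i hni) hi.not_gt

end Dispersion

/-! ### Runs of the algorithm and their correctness. -/

section Algorithm

variable {K : Type*} [Field K] {r : ℕ} {E : Equation K r}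

theorem exists_isLcm (a b : MvPolynomial (Fin r) K) : ∃ c, IsLcm a b c :=
  letI := UniqueFactorizationMonoid.toGCDMonoid (MvPolynomial (Fin r) K)
  ⟨lcm a b, fun _ => lcm_dvd_iff⟩

theorem Equation.exists_enumeratesCornerFactors (E : Equation K r) :
    ∃ l, E.EnumeratesCornerFactors l := by
  classical
  let C := E.S.filter (IsCornerPoint E.S)
  refine ⟨C.toList.flatMap fun q => (UniqueFactorizationMonoid.factors (E.a q)).toList,
    fun u hu => ?_, fun q hq u hu huq => ?_⟩
  · obtain ⟨q, hq, hu⟩ := List.mem_flatMap.1 hu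
    rw [Multiset.mem_toList] at hu
    rw [Finset.mem_toList, Finset.mem_filter] at hq
    exact ⟨UniqueFactorizationMonoid.irreducible_of_factor u hu, q, hq.2,
      UniqueFactorizationMonoid.dvd_of_mem_factors hu⟩
  · obtain ⟨c, hc, huc⟩ :=
      UniqueFactorizationMonoid.exists_mem_factors_of_dvd (E.a_ne_zero q hq.1) hu huq
    exact ⟨c, List.mem_flatMap.2 ⟨q, Finset.mem_toList.2 (Finset.mem_filter.2 ⟨hq.1, hq⟩),
      Multiset.mem_toList.2 hc⟩, huc⟩

theorem Equation.exists_run (E : Equation K r) (l : List (MvPolynomial (Fin r) K)) :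
    ∃ d, E.Run l d := by
  induction l with
  | nil => exact ⟨1, .start⟩
  | cons u l ih =>
    obtain ⟨d, hd⟩ := ih
    by_cases hu : E.SpreadInU u
    · obtain ⟨W, hW, hWu⟩ := id hu
      obtain ⟨d₀, hd₀⟩ := E.exists_isDenominatorBound hW
      obtain ⟨d', hd'⟩ := exists_isLcm d d₀
      exact ⟨d', .update l u d d₀ d' hd hu (hWu ▸ hd₀) hd'⟩
    · exact ⟨d, .skip l u d hd hu⟩

theorem Equation.Run.ne_zero {l : List (MvPolynomial (Fin r) K)} {d : MvPolynomial (Fin r) K}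
    (h : E.Run l d) : d ≠ 0 := by
  induction h with
  | start => exact one_ne_zero
  | update l u d d₀ d' _ _ hd₀ hlcm ih =>
    exact ne_zero_of_dvd_ne_zero (mul_ne_zero ih hd₀.1)
      ((hlcm _).2 ⟨dvd_mul_right _ _, dvd_mul_left _ _⟩)
  | skip l u d _ _ ih => exact ih

theorem Equation.Run.exists_dvd {l : List (MvPolynomial (Fin r) K)} {d : MvPolynomial (Fin r) K}
    (h : E.Run l d) {u : MvPolynomial (Fin r) K} (hu : u ∈ l) (hU : E.SpreadInU u) :
    ∃ d₀, E.IsDenominatorBound (spread u u) d₀ ∧ d₀ ∣ d := by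
  induction h with
  | start => exact absurd hu List.not_mem_nil
  | update l w d d₀ d' _ _ hd₀ hlcm ih =>
    obtain ⟨hd, hd₀d⟩ := (hlcm d').1 dvd_rfl
    rcases List.mem_cons.1 hu with rfl | hul
    · exact ⟨d₀, hd₀, hd₀d⟩
    · obtain ⟨d₁, hd₁, hdvd⟩ := ih hul
      exact ⟨d₁, hd₁, hdvd.trans hd⟩
  | skip l w d _ hw ih =>
    rcases List.mem_cons.1 hu with rfl | hul
    · exact absurd hU hw
    · exact ih hul

theorem Equation.IsOutput.isDenominatorBound {d : MvPolynomial (Fin r) K} (h : E.IsOutput d)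
    {Ws : Set (Submodule ℤ (Fin r → ℤ))} (hfin : Ws.Finite) (hWs : Ws ⊆ usefulModules E.S) :
    E.IsDenominatorBound (⋃ W ∈ Ws, (W : Set (Fin r → ℤ))) d := by
  obtain ⟨l, hl, hrun⟩ := h
  refine ⟨hrun.ne_zero, fun a q hq haq hy u hu huW m hm => ?_⟩
  by_cases h0 : IntegralAt u
      (algebraMap _ (RatFunc K r) a / algebraMap _ (RatFunc K r) q)
  · exact pow_dvd_of_integralAt hu hq haq ((integralAt_algebraMap hu d).mul hu h0) hm
  have hW : spreadModule u hu ∈ usefulModules E.S :=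
    mem_usefulModules_of_subset_biUnion hfin hWs huW
  obtain ⟨v, p, p', hv, hp, -⟩ := exists_isVertex_of_mem_usefulModules hW
  obtain ⟨i, hi, hmax⟩ := exists_maximal_not_integralAt hu hv h0
  -- The list entry `w` is only a shift of `u` up to units; equality of the spreads makes its bound
  -- apply to `u`.
  obtain ⟨w, hwl, huw⟩ := hl.2 p hp.isCornerPoint _ (irreducible_shift hu (p - i))
    (hy.shift_dvd_of_maximal hu hp hi hmax)
  have hs : spread u u = spread w w := by
    rw [← spread_shift u hu (p - i), spread_congr (irreducible_shift hu (p - i)) huw]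
  obtain ⟨d₀, hd₀, hdvd⟩ := hrun.exists_dvd hwl ⟨_, hW, hs⟩
  exact (hd₀.2 a q hq haq hy u hu hs.le m hm).trans hdvd

end Algorithm

end PLDE

theorem mainTheorem5 {K : Type*} [Field K] [CharZero K] {r : ℕ} (E : PLDE.Equation K r) :
    (∃ d, E.IsOutput d) ∧
      ∀ d, E.IsOutput d →
        ∀ Ws : Set (Submodule ℤ (Fin r → ℤ)), Ws.Finite → Ws ⊆ PLDE.usefulModules E.S →
          E.IsDenominatorBound (⋃ W ∈ Ws, (W : Set (Fin r → ℤ))) d := by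
  obtain ⟨l, hl⟩ := E.exists_enumeratesCornerFactors
  obtain ⟨d, hd⟩ := E.exists_run l
  exact ⟨⟨d, l, hl, hd⟩, fun d hd Ws hfin hWs => hd.isDenominatorBound hfin hWs⟩
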